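/- Let $d\ge 1$, let $a(x)=(4\pi)^{-d/2}e^{-|x|^2/4}$ for $x\in\mathbb R^d$, let $a^{*k}$ denote the $k$-fold convolution of $a$ with itself ($a^{*1}=a$, $a^{*(k+1)}=a^{*k}*a$), and for $t>0$ let $$v(x,t)=e^{-t}\sum_{k=1}^\infty \frac{t^k a^{*k}(x)}{k!}$$ (all convolutions and the series converge). For $r\in\mathbb R$ let $\xi_r>0$ be the unique positive solution of $\xi^2\ln\xi=r^2/4$, and put $\Phi_G(r)=1+2\xi_r\ln\xi_r-\xi_r$. Then, as $t\to\infty$, where in each item the limit or $o$-relation is uniform over all $x$ in the indicated region: 1. For every $r>0$, if $|x|\le r t^{1/2}$, then $$v(x,t)=\frac{1}{(4\pi t)^{d/2}}\,e^{-\frac{|x|^2}{4t}}\bigl(1+o(t^{-1/4})\bigr).$$ 2. For every $r>0$ and $0<\delta<1$, if $|x|=r t^{\frac{1+\delta}{2}}$, then $$\frac{\ln v(x,t)}{|x|^2/(4t)}\to-1 .$$ Moreover, for all $0<r_1<r_2$ and $0<\delta<1$, if $r_1t^{\frac{1+\delta}{2}}\le|x|\le r_2t^{\frac{1+\delta}{2}}$,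 then $$e^{-\frac{r_2^2}{4}t^\delta(1+o(1))}\le v(x,t)\le e^{-\frac{r_1^2}{4}t^\delta(1+o(1))} .$$ 3. For every $r>0$, if $|x|=rt$, then $$\frac{\ln v(x,t)}{t}\to-\Phi_G(r).$$ Furthermore, $0<\Phi_G(r)<r^2/4$ for all $r\neq0$; $\Phi_G(r)=\frac{r^2}{4}(1+o(1))$ as $r\to0+$; and $\Phi_G(r)=r\sqrt{\ln r}\,(1+o(1))$ as $r\to\infty$. 4. For every $\delta>1$, if $|x|>t^{\frac{1+\delta}{2}}$, then $$\frac{\ln v(x,t)}{|x|\sqrt{\ln\frac{|x|}{t}}}\to-1 .$$ -/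

import Mathlib

open Filter Topology MeasureTheory Asymptotics

noncomputable section

/-- The iterated convolution `a^{*(n+1)}` of a kernel on `ℝ^d` with respect to Lebesgue measure:
index `0` is `a` itself, and index `n + 1` is the convolution of index `n` with `a`. -/
def convPowSucc {d : ℕ} (a : EuclideanSpace ℝ (Fin d) → ℝ) :
    ℕ → EuclideanSpace ℝ (Fin d) → ℝ
  | 0 => a
  | n + 1 => convolution (convPowSucc a n) a (ContinuousLinearMap.mul ℝ ℝ) volume

/-- The regularised heat kernel `v(x,t) = e^{-t} ∑_{k ≥ 1} t^k a^{*k}(x) / k!`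
(the summation index is `n = k - 1`). -/
def regHeatKernel {d : ℕ} (a : EuclideanSpace ℝ (Fin d) → ℝ)
    (x : EuclideanSpace ℝ (Fin d)) (t : ℝ) : ℝ :=
  Real.exp (-t) * ∑' n : ℕ, t ^ (n + 1) * convPowSucc a n x / ((n + 1).factorial : ℝ)

/-- The Gaussian convolution kernel `a(x) = (4π)^{-d/2} e^{-|x|²/4}` on `ℝ^d`. -/
def gaussKernel (d : ℕ) (x : EuclideanSpace ℝ (Fin d)) : ℝ :=
  (4 * Real.pi) ^ (-((d : ℝ) / 2)) * Real.exp (-(‖x‖ ^ 2 / 4))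

/-- The classical heat kernel `(4πt)^{-d/2} e^{-|x|²/(4t)}` on `ℝ^d`. -/
def classicalHeatKernel (d : ℕ) (x : EuclideanSpace ℝ (Fin d)) (t : ℝ) : ℝ :=
  (4 * Real.pi * t) ^ (-((d : ℝ) / 2)) * Real.exp (-(‖x‖ ^ 2 / (4 * t)))

/-- The regime `t → ∞` with `(x,t)` restricted to a region `S` of space-time. Limits and
`o`-relations along this filter are uniform over all `x` with `(x,t) ∈ S`. -/
def regime {d : ℕ} (S : Set (EuclideanSpace ℝ (Fin d) × ℝ)) :
    Filter (EuclideanSpace ℝ (Fin d) × ℝ) :=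
  comap Prod.snd atTop ⊓ 𝓟 S

/-- The equation `ξ² ln ξ = r²/4` has exactly one solution `ξ > 0`. -/
theorem existsUnique_xi (r : ℝ) :
    ∃! ξ : ℝ, 0 < ξ ∧ ξ ^ 2 * Real.log ξ = r ^ 2 / 4 := by
  have hc : ContinuousOn (fun ξ : ℝ => ξ ^ 2 * Real.log ξ) (Set.Icc 1 (Real.exp (r ^ 2 / 4))) := by
    apply ContinuousOn.mul (by fun_prop)
    apply Real.continuousOn_log.mono
    intro y hy
    have := hy.1
    simp only [Set.mem_compl_iff, Set.mem_singleton_iff]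
    linarith
  have hr : 0 ≤ r ^ 2 / 4 := by positivity
  have h1 : (1 : ℝ) ≤ Real.exp (r ^ 2 / 4) := Real.one_le_exp hr
  have hmem : r ^ 2 / 4 ∈ Set.Icc ((fun ξ : ℝ => ξ ^ 2 * Real.log ξ) 1)
      ((fun ξ : ℝ => ξ ^ 2 * Real.log ξ) (Real.exp (r ^ 2 / 4))) := by
    refine ⟨by simpa using hr, ?_⟩
    simp only [Real.log_exp]
    have : (1 : ℝ) ≤ Real.exp (r ^ 2 / 4) ^ 2 := one_le_pow₀ h1
    exact le_mul_of_one_le_left hr this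
  have key : ∀ y : ℝ, 0 < y → y ^ 2 * Real.log y = r ^ 2 / 4 → 1 ≤ y := by
    intro y hy hy2
    by_contra! h
    have h3 := Real.log_neg hy h
    have h4 : 0 < y ^ 2 := by positivity
    nlinarith
  have mono : ∀ y z : ℝ, 1 ≤ y → y < z → y ^ 2 * Real.log y < z ^ 2 * Real.log z := by
    intro y z hy hyz
    have h3 := Real.log_nonneg hy
    have h4 : Real.log y < Real.log z := Real.log_lt_log (by linarith) hyz
    have h5 : y ^ 2 ≤ z ^ 2 := by nlinarith
    have h6 : 0 < z ^ 2 := by nlinarith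
    nlinarith
  obtain ⟨ξ, hξ, hξ2⟩ := intermediate_value_Icc h1 hc hmem
  have hpos : 0 < ξ := lt_of_lt_of_le one_pos hξ.1
  refine ⟨ξ, ⟨hpos, hξ2⟩, ?_⟩
  rintro y ⟨hy, hy2⟩
  have hy1 := key y hy hy2
  have hξ3 : ξ ^ 2 * Real.log ξ = r ^ 2 / 4 := hξ2
  rcases lt_trichotomy y ξ with h | h | h
  · have := mono y ξ hy1 h
    linarith
  · exact h
  · have := mono ξ y hξ.1 h
    linarith

/-- The solution `ξ_r > 0` of `ξ² ln ξ = r²/4`. -/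
def xiG (r : ℝ) : ℝ := (existsUnique_xi r).choose

theorem xiG_pos (r : ℝ) : 0 < xiG r := (existsUnique_xi r).choose_spec.1.1

theorem xiG_eq (r : ℝ) : xiG r ^ 2 * Real.log (xiG r) = r ^ 2 / 4 :=
  (existsUnique_xi r).choose_spec.1.2

/-- The rate function `Φ_G(r) = 1 + 2 ξ_r ln ξ_r - ξ_r`. -/
def PhiG (r : ℝ) : ℝ := 1 + 2 * xiG r * Real.log (xiG r) - xiG r

end

/-!
The semigroup property of Gaussians (`convolution_classicalHeatKernel`) identifies the `k`-fold
convolution of `a` with the heat kernel `h_k` at time `k`, so `v(x,t)` is the average of `h_N(x)`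
over a Poisson variable `N` of mean `t`, with the value `0` at `N = 0` (`hasSum_regHeatKernel`).

In the central regime `|x| ≤ r t^{1/2}`, the quotient `h_N / h_t` is a Lipschitz function of `N / t`
on `N ≥ t / 2`. Since `N / t - 1` is of order `t^{-1/2}` and `N < t / 2` has exponentially small
probability, the relative error is `O(t^{-1/2})`. Both estimates are reduced to the Laplace transform
`E[q^N] = e^{t(q - 1)}`, so that no moments of `N` are needed (`abs_regHeatKernel_div_sub_one_le`).

All the other regimes follow from one two-sided bound. From above, `-|x|²/(4k) ≤ θ²k - θ|x|` for
every `θ` gives `v ≤ exp (t (e^{θ²} - 1) - θ|x|)`, and the choice `e^{θ²} = ξ_r` with `r = |x|/t`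
gives `v ≤ exp (-t Φ_G(r))` (`regHeatKernel_le_exp_neg_PhiG`). From below, the single term with
`k = ⌈t ξ_r⌉` and Stirling's formula give `ln v ≥ -t Φ_G(r) - C (1 + ln (t ξ_r))` with `C`
depending on `d` only (`exists_le_log_regHeatKernel`). In each regime `ln (t ξ_r)` is negligible
against `t Φ_G(r)`, and the limits are read off from the behaviour of `Φ_G` at `0` and at `∞`. With
`s = ln ξ_r`, one has `r²/4 = s e^{2s}` and `Φ_G(r) = 1 + 2 s e^s - e^s`, whence
`(r²/4) e^{-r²/4} ≤ Φ_G(r) ≤ r²/4`; as `r → ∞`, `ln r ~ s` and `Φ_G(r) ~ r √s`.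
-/


/-! ### Convolution powers of the Gaussian -/

theorem classicalHeatKernel_pos {d : ℕ} (x : EuclideanSpace ℝ (Fin d)) {t : ℝ} (ht : 0 < t) :
    0 < classicalHeatKernel d x t := by
  unfold classicalHeatKernel
  have := Real.pi_pos
  positivity

theorem classicalHeatKernel_one (d : ℕ) (x : EuclideanSpace ℝ (Fin d)) :
    classicalHeatKernel d x 1 = gaussKernel d x := by
  simp [classicalHeatKernel, gaussKernel]

/-- Completing the square in the exponent of a product of two Gaussians. -/
theorem sq_norm_div_add_sq_norm_sub_div {E : Type*} [NormedAddCommGroup E] [InnerProductSpace ℝ E]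
    (x y : E) {s t : ℝ} (hs : 0 < s) (ht : 0 < t) :
    ‖y‖ ^ 2 / (4 * s) + ‖x - y‖ ^ 2 / (4 * t) =
      (s + t) / (4 * s * t) * ‖y - (s / (s + t)) • x‖ ^ 2 + ‖x‖ ^ 2 / (4 * (s + t)) := by
  rw [norm_sub_sq_real, norm_sub_sq_real, norm_smul, inner_smul_right, real_inner_comm,
    Real.norm_of_nonneg (by positivity)]
  field_simp
  ring

theorem integrable_exp_neg_mul_sq_norm {E : Type*} [NormedAddCommGroup E] [InnerProductSpace ℝ E]
    [FiniteDimensional ℝ E] [MeasurableSpace E] [BorelSpace E] {b : ℝ} (hb : 0 < b) :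
    Integrable fun y : E => Real.exp (-b * ‖y‖ ^ 2) := by
  have h := (GaussianFourier.integrable_cexp_neg_mul_sq_norm_add (V := E) (b := (b : ℂ))
    (by simpa using hb) 0 0).re
  refine h.congr (Eventually.of_forall fun y => ?_)
  have : (-(b : ℂ) * (‖y‖ : ℂ) ^ 2 + 0 * ((inner ℝ (0 : E) y : ℝ) : ℂ)) =
      ((-b * ‖y‖ ^ 2 : ℝ) : ℂ) := by
    push_cast; ring
  simp only [this]
  rw [← Complex.ofReal_exp]
  exact Complex.ofReal_re _

theorem classicalHeatKernel_mul_classicalHeatKernel_sub {d : ℕ} (x y : EuclideanSpace ℝ (Fin d))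
    {s t : ℝ} (hs : 0 < s) (ht : 0 < t) :
    classicalHeatKernel d y s * classicalHeatKernel d (x - y) t =
      ((4 * Real.pi * s) ^ (-((d : ℝ) / 2)) * (4 * Real.pi * t) ^ (-((d : ℝ) / 2)) *
        Real.exp (-(‖x‖ ^ 2 / (4 * (s + t))))) *
        Real.exp (-((s + t) / (4 * s * t)) * ‖y - (s / (s + t)) • x‖ ^ 2) := by
  unfold classicalHeatKernel
  rw [mul_mul_mul_comm, ← Real.exp_add, mul_assoc _ (Real.exp _), ← Real.exp_add]
  have := sq_norm_div_add_sq_norm_sub_div x y hs ht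
  congr 2
  linarith

theorem convolutionExists_classicalHeatKernel (d : ℕ) {s t : ℝ} (hs : 0 < s) (ht : 0 < t) :
    ConvolutionExists (fun x => classicalHeatKernel d x s) (fun x => classicalHeatKernel d x t)
      (ContinuousLinearMap.mul ℝ ℝ) volume := by
  intro x
  unfold ConvolutionExistsAt
  simp only [ContinuousLinearMap.mul_apply', classicalHeatKernel_mul_classicalHeatKernel_sub x _
    hs ht]
  exact ((integrable_exp_neg_mul_sq_norm (by positivity)).comp_sub_right _).const_mul _

/-- The heat kernels form a convolution semigroup. -/
theorem convolution_classicalHeatKernel (d : ℕ) {s t : ℝ} (hs : 0 < s) (ht : 0 < t) :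
    convolution (fun x => classicalHeatKernel d x s) (fun x => classicalHeatKernel d x t)
      (ContinuousLinearMap.mul ℝ ℝ) volume = fun x => classicalHeatKernel d x (s + t) := by
  ext x
  rw [convolution_def]
  simp only [ContinuousLinearMap.mul_apply', classicalHeatKernel_mul_classicalHeatKernel_sub x _
    hs ht]
  have hπ := Real.pi_pos
  rw [integral_const_mul, integral_sub_right_eq_self
    (fun y : EuclideanSpace ℝ (Fin d) => Real.exp (-((s + t) / (4 * s * t)) * ‖y‖ ^ 2)),
    GaussianFourier.integral_rexp_neg_mul_sq_norm (by positivity), classicalHeatKernel,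
    mul_right_comm]
  congr 1
  rw [finrank_euclideanSpace, Fintype.card_fin, ← Real.mul_rpow (by positivity) (by positivity),
    ← neg_neg ((d : ℝ) / 2), Real.rpow_neg (by positivity) (-((d : ℝ) / 2)),
    ← Real.inv_rpow (by positivity), neg_neg, ← Real.mul_rpow (by positivity) (by positivity)]
  congr 1
  field_simp

theorem convPowSucc_gaussKernel (d n : ℕ) :
    convPowSucc (gaussKernel d) n = fun x => classicalHeatKernel d x (n + 1) := by
  have h1 : gaussKernel d = fun x => classicalHeatKernel d x 1 :=
    funext fun x => (classicalHeatKernel_one d x).symm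
  induction n with
  | zero => simpa [convPowSucc] using h1
  | succ n ih =>
    rw [convPowSucc, ih, h1, convolution_classicalHeatKernel d (by positivity) one_pos]
    push_cast
    rfl

theorem convolutionExists_convPowSucc_gaussKernel (d n : ℕ) :
    ConvolutionExists (convPowSucc (gaussKernel d) n) (gaussKernel d)
      (ContinuousLinearMap.mul ℝ ℝ) volume := by
  rw [convPowSucc_gaussKernel, show gaussKernel d = fun x => classicalHeatKernel d x 1 from
    funext fun x => (classicalHeatKernel_one d x).symm]
  exact convolutionExists_classicalHeatKernel d (by positivity) one_pos

/-! ### The Poisson series -/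

theorem Real.hasSum_pow_div_factorial (x : ℝ) :
    HasSum (fun n : ℕ => x ^ n / (n.factorial : ℝ)) (Real.exp x) := by
  rw [Real.exp_eq_exp_ℝ]
  exact NormedSpace.expSeries_div_hasSum_exp x

/-- The Laplace transform of the Poisson distribution. -/
theorem hasSum_poisson_mul_pow (t q : ℝ) :
    HasSum (fun n : ℕ => Real.exp (-t) * (t ^ n / (n.factorial : ℝ)) * q ^ n)
      (Real.exp (t * (q - 1))) := by
  have h := (Real.hasSum_pow_div_factorial (t * q)).mul_left (Real.exp (-t))
  rw [← Real.exp_add, show -t + t * q = t * (q - 1) by ring] at h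
  refine h.congr_fun ?_
  intro n
  rw [mul_pow]
  ring

/-- For `s ≥ 1` the prefactor is at most `1`, and `(|x| / (2√s) - θ√s)² ≥ 0` linearizes the Gaussian
exponent in `s`, so that the Poisson average of the right-hand side is explicit. -/
theorem classicalHeatKernel_le_exp {d : ℕ} (x : EuclideanSpace ℝ (Fin d)) {s : ℝ} (hs : 1 ≤ s)
    (θ : ℝ) : classicalHeatKernel d x s ≤ Real.exp (θ ^ 2 * s - θ * ‖x‖) := by
  have hs0 : 0 < s := by linarith
  have h4 : 1 ≤ 4 * Real.pi * s := by nlinarith [Real.pi_gt_three]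
  rw [classicalHeatKernel, ← one_mul (Real.exp (θ ^ 2 * s - θ * ‖x‖))]
  gcongr
  · exact Real.rpow_le_one_of_one_le_of_nonpos h4 (by simp; positivity)
  · rw [neg_le_iff_add_nonneg]
    have : θ ^ 2 * s - θ * ‖x‖ + ‖x‖ ^ 2 / (4 * s) = (‖x‖ - 2 * θ * s) ^ 2 / (4 * s) := by
      field_simp
      ring
    rw [this]
    positivity

theorem summable_regHeatKernel {d : ℕ} (x : EuclideanSpace ℝ (Fin d)) {t : ℝ} (ht : 0 < t) :
    Summable fun n : ℕ =>
      t ^ (n + 1) * convPowSucc (gaussKernel d) n x / ((n + 1).factorial : ℝ) := by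
  have h := ((summable_nat_add_iff 1).2 (Real.hasSum_pow_div_factorial t).summable)
  refine Summable.of_nonneg_of_le (fun n => ?_) (fun n => ?_) h
  · rw [convPowSucc_gaussKernel]
    have := classicalHeatKernel_pos x (t := (n : ℝ) + 1) (by positivity)
    positivity
  · rw [convPowSucc_gaussKernel]
    have := classicalHeatKernel_le_exp x (s := (n : ℝ) + 1) (by simp) 0
    simp only [ne_eq, OfNat.ofNat_ne_zero, not_false_eq_true, zero_pow, zero_mul, sub_zero,
      Real.exp_zero] at this
    gcongr
    exact mul_le_of_le_one_right (by positivity) this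

/-- The series of `regHeatKernel` is a Poisson average of heat kernels; the index is the number of
factors, with no contribution from `k = 0`. -/
theorem hasSum_regHeatKernel {d : ℕ} (x : EuclideanSpace ℝ (Fin d)) {t : ℝ} (ht : 0 < t) :
    HasSum (fun k : ℕ => Real.exp (-t) * (t ^ k / (k.factorial : ℝ)) *
        if k = 0 then 0 else classicalHeatKernel d x k)
      (regHeatKernel (gaussKernel d) x t) := by
  rw [← hasSum_nat_add_iff' 1]
  simp only [Finset.range_one, Finset.sum_singleton, if_true, mul_zero, sub_zero]
  refine ((summable_regHeatKernel x ht).hasSum.mul_left (Real.exp (-t))).congr_fun fun n => ?_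
  rw [convPowSucc_gaussKernel, if_neg (Nat.succ_ne_zero n)]
  push_cast
  ring

theorem regHeatKernel_le_exp {d : ℕ} (x : EuclideanSpace ℝ (Fin d)) {t : ℝ} (ht : 0 < t) (θ : ℝ) :
    regHeatKernel (gaussKernel d) x t ≤ Real.exp (t * (Real.exp (θ ^ 2) - 1) - θ * ‖x‖) := by
  have h := (hasSum_poisson_mul_pow t (Real.exp (θ ^ 2))).mul_right (Real.exp (-(θ * ‖x‖)))
  rw [← Real.exp_add, ← sub_eq_add_neg] at h
  refine hasSum_le (fun k => ?_) (hasSum_regHeatKernel x ht) h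
  rw [mul_assoc _ (_ ^ k)]
  refine mul_le_mul_of_nonneg_left ?_ (by positivity)
  split_ifs with hk
  · positivity
  · refine (classicalHeatKernel_le_exp x (by exact_mod_cast Nat.one_le_iff_ne_zero.2 hk) θ).trans ?_
    rw [← Real.exp_nat_mul, ← Real.exp_add]
    apply le_of_eq
    congr 1
    ring

/-- All terms of the series are nonnegative, so each single term is a lower bound. -/
theorem term_le_regHeatKernel {d : ℕ} (x : EuclideanSpace ℝ (Fin d)) {t : ℝ} (ht : 0 < t)
    {k : ℕ} (hk : k ≠ 0) :
    Real.exp (-t) * (t ^ k / (k.factorial : ℝ)) * classicalHeatKernel d x k ≤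
      regHeatKernel (gaussKernel d) x t := by
  have h := le_hasSum (hasSum_regHeatKernel x ht) k fun j _ => by
    split_ifs with hj
    · simp
    · have := classicalHeatKernel_pos x (t := (j : ℝ)) (by positivity)
      positivity
  rwa [if_neg hk] at h

theorem regHeatKernel_gaussKernel_pos {d : ℕ} (x : EuclideanSpace ℝ (Fin d)) {t : ℝ} (ht : 0 < t) :
    0 < regHeatKernel (gaussKernel d) x t := by
  refine lt_of_lt_of_le ?_ (term_le_regHeatKernel x ht one_ne_zero)
  have := classicalHeatKernel_pos x (t := ((1 : ℕ) : ℝ)) (by simp)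
  positivity

/-! ### The saddle point `ξ_r` and the rate function -/

theorem one_le_xiG (r : ℝ) : 1 ≤ xiG r := by
  by_contra! h
  have h1 := Real.log_neg (xiG_pos r) h
  have h2 := xiG_eq r
  have h3 := pow_pos (xiG_pos r) 2
  nlinarith [sq_nonneg r]

theorem log_xiG_nonneg (r : ℝ) : 0 ≤ Real.log (xiG r) :=
  Real.log_nonneg (one_le_xiG r)

/-- The saddle point equation `ξ² ln ξ = r²/4` after taking square roots. -/
theorem two_mul_xiG_mul_sqrt_log {r : ℝ} (hr : 0 ≤ r) :
    2 * xiG r * √(Real.log (xiG r)) = r := by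
  have h := xiG_eq r
  have h0 := xiG_pos r
  refine (pow_left_inj₀ (by positivity) hr two_ne_zero).1 ?_
  rw [mul_pow, Real.sq_sqrt (log_xiG_nonneg r)]
  linarith

theorem log_xiG_le (r : ℝ) : Real.log (xiG r) ≤ r ^ 2 / 4 := by
  rw [← xiG_eq r]
  exact le_mul_of_one_le_left (log_xiG_nonneg r) (one_le_pow₀ (one_le_xiG r))

theorem log_xiG_pos {r : ℝ} (hr : r ≠ 0) : 0 < Real.log (xiG r) := by
  refine (log_xiG_nonneg r).lt_of_ne fun h => ?_
  have := xiG_eq r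
  rw [← h, mul_zero] at this
  have : 0 < r ^ 2 / 4 := by positivity
  linarith

/-- With `s = ln ξ_r`, one has `Φ = 1 + 2 s e^s - e^s ≥ s e^s = (r²/4) e^{-s}`, because
`e^{-s} ≥ 1 - s`. -/
theorem mul_exp_le_PhiG (r : ℝ) : r ^ 2 / 4 * Real.exp (-(r ^ 2 / 4)) ≤ PhiG r := by
  have h0 := xiG_pos r
  have hs := log_xiG_nonneg r
  have h1 := Real.add_one_le_exp (-Real.log (xiG r))
  rw [Real.exp_neg, Real.exp_log h0] at h1
  have h2 : xiG r * Real.log (xiG r) ≤ PhiG r := by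
    have := mul_le_mul_of_nonneg_left h1 h0.le
    rw [mul_inv_cancel₀ h0.ne'] at this
    unfold PhiG
    linarith
  refine le_trans ?_ h2
  have h3 : Real.exp (-(r ^ 2 / 4)) ≤ (xiG r)⁻¹ := by
    have := Real.exp_le_exp.2 (neg_le_neg (log_xiG_le r))
    rwa [Real.exp_neg (Real.log (xiG r)), Real.exp_log h0] at this
  calc r ^ 2 / 4 * Real.exp (-(r ^ 2 / 4)) ≤ r ^ 2 / 4 * (xiG r)⁻¹ := by gcongr
    _ = xiG r * Real.log (xiG r) := by
      rw [← xiG_eq r]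
      field_simp

theorem PhiG_pos {r : ℝ} (hr : r ≠ 0) : 0 < PhiG r :=
  lt_of_lt_of_le (by positivity) (mul_exp_le_PhiG r)

/-- The gap `r²/4 - Φ` equals `s (ξ - 1)² + (ξ - 1 - s)` with `s = ln ξ_r`. -/
theorem PhiG_lt {r : ℝ} (hr : r ≠ 0) : PhiG r < r ^ 2 / 4 := by
  have h0 := xiG_pos r
  have hs := log_xiG_pos hr
  have h1 : xiG r ≠ 1 := fun h => by simp [h] at hs
  have h2 := Real.log_lt_sub_one_of_pos h0 h1
  rw [← xiG_eq r, PhiG]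
  nlinarith [mul_nonneg hs.le (sq_nonneg (xiG r - 1))]

theorem PhiG_isEquivalent_nhdsGT : PhiG ~[𝓝[>] 0] fun r => r ^ 2 / 4 := by
  refine (isEquivalent_iff_tendsto_one ?_).2 ?_
  · filter_upwards [self_mem_nhdsWithin] with r (hr : 0 < r)
    positivity
  · have hlim : Tendsto (fun r : ℝ => Real.exp (-(r ^ 2 / 4))) (𝓝[>] 0) (𝓝 1) := by
      have : Continuous fun r : ℝ => Real.exp (-(r ^ 2 / 4)) := by fun_prop
      simpa using (this.tendsto 0).mono_left nhdsWithin_le_nhds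
    refine tendsto_of_tendsto_of_tendsto_of_le_of_le' hlim tendsto_const_nhds ?_ ?_
    · filter_upwards [self_mem_nhdsWithin] with r (hr : 0 < r)
      rw [Pi.div_apply, le_div_iff₀ (by positivity), mul_comm]
      exact mul_exp_le_PhiG r
    · filter_upwards [self_mem_nhdsWithin] with r (hr : 0 < r)
      rw [Pi.div_apply, div_le_one (by positivity)]
      exact (PhiG_lt hr.ne').le

theorem tendsto_log_xiG_atTop : Tendsto (fun r => Real.log (xiG r)) atTop atTop := by
  have h1 : Tendsto (fun r : ℝ => Real.log (r ^ 2 / 4) / 3) atTop atTop := by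
    refine Tendsto.atTop_div_const (by norm_num) (Real.tendsto_log_atTop.comp ?_)
    exact (tendsto_pow_atTop two_ne_zero).atTop_div_const (by norm_num)
  refine tendsto_atTop_mono' _ ?_ h1
  filter_upwards [eventually_gt_atTop 0] with r hr
  -- `r² / 4 = ξ² ln ξ ≤ ξ³`
  have h2 : r ^ 2 / 4 ≤ xiG r ^ 3 := by
    rw [← xiG_eq r, pow_succ (xiG r) 2]
    have := xiG_pos r
    have := Real.log_le_self (xiG_pos r).le
    gcongr
  have h3 := Real.log_le_log (by positivity) h2
  rw [Real.log_pow] at h3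
  push_cast at h3
  linarith

theorem log_eq_log_xiG {r : ℝ} (hr : 0 < r) :
    Real.log r = Real.log 2 + Real.log (xiG r) + Real.log (Real.log (xiG r)) / 2 := by
  have h := xiG_pos r
  have h2 := log_xiG_pos hr.ne'
  conv_lhs => rw [← two_mul_xiG_mul_sqrt_log hr.le]
  rw [Real.log_mul (by positivity) (by positivity), Real.log_mul (by positivity) (by positivity),
    Real.log_sqrt h2.le]

/-- `ln r ~ ln ξ_r` as `r → ∞`. -/
theorem tendsto_log_div_log_xiG :
    Tendsto (fun r => Real.log r / Real.log (xiG r)) atTop (𝓝 1) := by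
  have h1 : Tendsto (fun s : ℝ => Real.log 2 / s + 1 + Real.log s / s / 2) atTop (𝓝 1) := by
    have ha : Tendsto (fun s : ℝ => Real.log 2 / s) atTop (𝓝 0) :=
      tendsto_const_nhds.div_atTop tendsto_id
    have hb : Tendsto (fun s : ℝ => Real.log s / s) atTop (𝓝 0) :=
      Real.isLittleO_log_id_atTop.tendsto_div_nhds_zero
    simpa using (ha.add_const 1).add (hb.div_const 2)
  refine (h1.comp tendsto_log_xiG_atTop).congr' ?_
  filter_upwards [eventually_gt_atTop 0] with r hr
  have h2 := log_xiG_pos hr.ne'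
  rw [log_eq_log_xiG hr, Function.comp_apply]
  field_simp

theorem PhiG_isEquivalent_atTop : PhiG ~[atTop] fun r => r * √(Real.log r) := by
  refine (isEquivalent_iff_tendsto_one ?_).2 ?_
  · filter_upwards [eventually_gt_atTop 1] with r hr
    have := Real.log_pos hr
    positivity
  · have ha : Tendsto (fun r => √(Real.log (xiG r) / Real.log r)) atTop (𝓝 1) := by
      have := (tendsto_log_div_log_xiG.inv₀ one_ne_zero).sqrt
      simpa using this
    have hl : Tendsto (fun r => √(Real.log r)) atTop atTop :=
      Real.tendsto_sqrt_atTop.comp Real.tendsto_log_atTop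
    have hx : Tendsto (fun r => √(Real.log (xiG r))) atTop atTop :=
      Real.tendsto_sqrt_atTop.comp tendsto_log_xiG_atTop
    have hb : Tendsto (fun r => 1 / (r * √(Real.log r))) atTop (𝓝 0) :=
      tendsto_const_nhds.div_atTop (tendsto_id.atTop_mul_atTop₀ hl)
    have hc : Tendsto (fun r => 1 / (2 * (√(Real.log (xiG r)) * √(Real.log r)))) atTop (𝓝 0) :=
      tendsto_const_nhds.div_atTop ((hx.atTop_mul_atTop₀ hl).const_mul_atTop two_pos)
    have := (hb.add ha).sub hc
    simp only [zero_add, sub_zero] at this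
    refine this.congr' ?_
    filter_upwards [eventually_gt_atTop 1] with r hr
    have h0 : 0 < √(Real.log r) := Real.sqrt_pos.2 (Real.log_pos hr)
    have h1 : 0 < √(Real.log (xiG r)) := Real.sqrt_pos.2 (log_xiG_pos (by positivity))
    have h2 := two_mul_xiG_mul_sqrt_log (r := r) (by positivity)
    have h3 := Real.sq_sqrt (log_xiG_nonneg r)
    have h4 := xiG_pos r
    rw [Pi.div_apply, PhiG, Real.sqrt_div (log_xiG_nonneg r)]
    generalize √(Real.log (xiG r)) = w at *
    generalize √(Real.log r) = z at *
    rw [← h3]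
    generalize xiG r = ξ at *
    subst h2
    field_simp

/-! ### Bounds for the kernel by the rate function -/

theorem regHeatKernel_le_exp_neg_PhiG {d : ℕ} {x : EuclideanSpace ℝ (Fin d)} {r t : ℝ}
    (ht : 0 < t) (hr : 0 ≤ r) (hx : r * t ≤ ‖x‖) :
    regHeatKernel (gaussKernel d) x t ≤ Real.exp (-(t * PhiG r)) := by
  refine (regHeatKernel_le_exp x ht √(Real.log (xiG r))).trans (Real.exp_le_exp.2 ?_)
  have h1 := two_mul_xiG_mul_sqrt_log hr
  have h2 := Real.sq_sqrt (log_xiG_nonneg r)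
  have h3 : √(Real.log (xiG r)) * (r * t) = 2 * xiG r * Real.log (xiG r) * t := by
    generalize √(Real.log (xiG r)) = w at *
    rw [← h2]
    generalize xiG r = ξ at *
    rw [← h1]
    ring
  have h4 := mul_le_mul_of_nonneg_left hx (Real.sqrt_nonneg (Real.log (xiG r)))
  rw [h2, Real.exp_log (xiG_pos r), PhiG]
  linarith

/-- One half of Stirling's formula, `k! ≤ e √k (k / e)^k`. -/
theorem log_factorial_le {k : ℕ} (hk : k ≠ 0) :
    Real.log k.factorial ≤ 1 + Real.log k / 2 + k * Real.log k - k := by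
  obtain ⟨n, rfl⟩ := Nat.exists_eq_succ_of_ne_zero hk
  have h1 : Real.log (Stirling.stirlingSeq (n + 1)) ≤ Real.log (Stirling.stirlingSeq 1) :=
    Real.log_le_log (Stirling.stirlingSeq'_pos n) (Stirling.stirlingSeq'_antitone (Nat.zero_le n))
  rw [Stirling.log_stirlingSeq_formula, Stirling.log_stirlingSeq_formula,
    Real.log_div (by positivity) (by positivity), Real.log_mul (by norm_num) (by positivity)] at h1
  simp at h1 ⊢
  linarith

/-- The exponent of the term with index `k` close to the saddle point `tξ` differs from
`-t Φ` by a bounded amount, because the saddle point is a critical point of the exponent. -/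
theorem saddle_exponent_le {t ξ k : ℝ} (ht : 1 ≤ t) (hξ : 1 ≤ ξ) (h1 : t * ξ ≤ k)
    (h2 : k ≤ t * ξ + 1) :
    -(t * (1 + 2 * ξ * Real.log ξ - ξ)) - 2 ≤
      -t + k * Real.log t - k * Real.log k + k - t ^ 2 * (ξ ^ 2 * Real.log ξ) / k := by
  have hm : 1 ≤ t * ξ := by nlinarith
  have hm' : ξ ≤ t * ξ := by nlinarith
  have hk : 0 < k := by linarith
  have hL : 0 ≤ Real.log ξ := Real.log_nonneg hξ
  have hLk : Real.log ξ ≤ k := (Real.log_le_self (by linarith)).trans (by linarith)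
  have hlog : Real.log k ≤ Real.log t + Real.log ξ + (k / (t * ξ) - 1) := by
    have h := Real.log_le_sub_one_of_pos (x := k / (t * ξ)) (by positivity)
    rw [Real.log_div (by positivity) (by positivity), Real.log_mul (by positivity) (by positivity)]
      at h
    linarith
  have hlog' := mul_le_mul_of_nonneg_left hlog hk.le
  -- `u = k - tξ` is the distance to the saddle point
  obtain ⟨u, rfl⟩ : ∃ u, k = t * ξ + u := ⟨k - t * ξ, by ring⟩
  have hu0 : 0 ≤ u := by linarith
  have hu1 : u ^ 2 ≤ 1 := pow_le_one₀ hu0 (by linarith)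
  generalize Real.log ξ = l at *
  have e1 : (t * ξ + u) * ((t * ξ + u) / (t * ξ) - 1) = u + u ^ 2 / (t * ξ) := by
    field_simp
    ring
  have e2 : t ^ 2 * (ξ ^ 2 * l) / (t * ξ + u) = l * (t * ξ - u) + u ^ 2 * (l / (t * ξ + u)) := by
    field_simp
    ring
  have b1 : u ^ 2 / (t * ξ) ≤ 1 := (div_le_one (by positivity)).2 (by linarith)
  have b2 : u ^ 2 * (l / (t * ξ + u)) ≤ 1 :=
    mul_le_one₀ hu1 (by positivity) ((div_le_one hk).2 hLk)
  rw [e2]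
  rw [mul_add, e1] at hlog'
  linarith

/-- The term with index `⌈tξ_r⌉` alone gives a lower bound that matches
`regHeatKernel_le_exp_neg_PhiG` up to a power of `tξ_r`. -/
theorem exists_le_log_regHeatKernel (d : ℕ) : ∃ C : ℝ, 0 ≤ C ∧
    ∀ (x : EuclideanSpace ℝ (Fin d)) (r t : ℝ), 1 ≤ t → ‖x‖ ≤ r * t →
      -(t * PhiG r) - C * (1 + Real.log (t * xiG r)) ≤
        Real.log (regHeatKernel (gaussKernel d) x t) := by
  have hπ := Real.pi_gt_three
  have hc4 : 0 ≤ Real.log (4 * Real.pi) := Real.log_nonneg (by linarith)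
  have hc2 : 0 ≤ Real.log 2 := Real.log_nonneg (by norm_num)
  refine ⟨3 + (1 + d) / 2 * (1 + Real.log 2) + d / 2 * Real.log (4 * Real.pi), by positivity, ?_⟩
  intro x r t ht hx
  have hξ := one_le_xiG r
  have hm : 1 ≤ t * xiG r := by nlinarith
  set k : ℕ := ⌈t * xiG r⌉₊ with hk
  have hk1 : t * xiG r ≤ k := Nat.le_ceil _
  have hk2 : (k : ℝ) ≤ t * xiG r + 1 := (Nat.ceil_lt_add_one (by positivity)).le
  have hk0 : (0 : ℝ) < k := by linarith
  have hk0' : k ≠ 0 := by exact_mod_cast hk0.ne'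
  have hheat := classicalHeatKernel_pos x hk0
  have hterm := Real.log_le_log (by positivity) (term_le_regHeatKernel x (t := t) (by linarith) hk0')
  rw [Real.log_mul (by positivity) hheat.ne', Real.log_mul (by positivity) (by positivity),
    Real.log_exp, Real.log_div (by positivity) (by positivity), Real.log_pow, classicalHeatKernel,
    Real.log_mul (by positivity) (by positivity), Real.log_exp, Real.log_rpow (by positivity),
    Real.log_mul (by positivity) hk0.ne'] at hterm
  have hfac := log_factorial_le hk0'
  have hsad := saddle_exponent_le ht hξ hk1 hk2
  have hlogk : Real.log k ≤ Real.log 2 + Real.log (t * xiG r) := by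
    rw [← Real.log_mul (by norm_num) (by positivity)]
    exact Real.log_le_log hk0 (by linarith)
  have hxx : ‖x‖ ^ 2 / (4 * k) ≤ t ^ 2 * (xiG r ^ 2 * Real.log (xiG r)) / k := by
    rw [xiG_eq, show t ^ 2 * (r ^ 2 / 4) / k = (r * t) ^ 2 / (4 * k) by field_simp]
    gcongr
  have hM : 0 ≤ Real.log (t * xiG r) := Real.log_nonneg hm
  have hd : 0 ≤ ((1 : ℝ) + d) / 2 := by positivity
  have hmul := mul_le_mul_of_nonneg_left hlogk hd
  have hextra : 0 ≤ (3 + ((1 : ℝ) + d) / 2 * Real.log 2 + d / 2 * Real.log (4 * Real.pi)) *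
      Real.log (t * xiG r) := by positivity
  rw [PhiG]
  linarith

/-! ### Passing to the limit in a space-time regime -/

section Regime

variable {d : ℕ} {S : Set (EuclideanSpace ℝ (Fin d) × ℝ)}

theorem tendsto_snd_regime : Tendsto Prod.snd (regime S) atTop :=
  tendsto_comap.mono_left inf_le_left

theorem eventually_mem_regime : ∀ᶠ p in regime S, p ∈ S :=
  mem_inf_of_right (mem_principal_self S)

theorem eventually_one_le_snd_regime :
    ∀ᶠ p : EuclideanSpace ℝ (Fin d) × ℝ in regime S, 1 ≤ p.2 :=
  tendsto_snd_regime.eventually_ge_atTop 1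

/-- The logarithmic asymptotics of the kernel, normalized by `N`, are those of `-t Φ(|x|/t)`,
provided that `N` dominates the logarithmic error of the two-sided bound. -/
theorem tendsto_log_regHeatKernel_div {r N : EuclideanSpace ℝ (Fin d) × ℝ → ℝ} {a : ℝ}
    (hr : ∀ᶠ p in regime S, 0 ≤ r p ∧ ‖p.1‖ = r p * p.2) (hN : ∀ᶠ p in regime S, 0 < N p)
    (hΦ : Tendsto (fun p => p.2 * PhiG (r p) / N p) (regime S) (𝓝 a))
    (herr : Tendsto (fun p => (1 + Real.log (p.2 * xiG (r p))) / N p) (regime S) (𝓝 0)) :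
    Tendsto (fun p => Real.log (regHeatKernel (gaussKernel d) p.1 p.2) / N p) (regime S)
      (𝓝 (-a)) := by
  obtain ⟨C, -, hC⟩ := exists_le_log_regHeatKernel d
  have hlow := hΦ.neg.sub (herr.const_mul C)
  rw [mul_zero, sub_zero] at hlow
  refine tendsto_of_tendsto_of_tendsto_of_le_of_le' hlow hΦ.neg ?_ ?_
  · filter_upwards [hr, hN, eventually_one_le_snd_regime] with p hp hNp ht
    rw [← neg_div, ← mul_div_assoc, ← sub_div]
    gcongr
    exact hC p.1 (r p) p.2 ht hp.2.le
  · filter_upwards [hr, hN, eventually_one_le_snd_regime] with p hp hNp ht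
    have ht0 : 0 < p.2 := by linarith
    rw [← neg_div]
    gcongr
    rw [Real.log_le_iff_le_exp (regHeatKernel_gaussKernel_pos p.1 ht0)]
    exact regHeatKernel_le_exp_neg_PhiG ht0 hp.1 hp.2.ge

end Regime

/-! ### Moderate deviations: `|x| = r t^{(1+δ)/2}` with `0 < δ < 1` -/

theorem rpow_half_mul_self {t : ℝ} (ht : 0 < t) (δ : ℝ) :
    t ^ ((δ - 1) / 2) * t = t ^ ((1 + δ) / 2) := by
  rw [← Real.rpow_add_one ht.ne']
  congr 1
  ring

theorem mul_sq_rpow_half {t : ℝ} (ht : 0 < t) (r δ : ℝ) :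
    t * ((r * t ^ ((δ - 1) / 2)) ^ 2 / 4) = r ^ 2 / 4 * t ^ δ := by
  rw [mul_pow, ← Real.rpow_mul_natCast ht.le,
    show t ^ δ = t ^ ((δ - 1) / 2 * (2 : ℕ)) * t by
      rw [← Real.rpow_add_one ht.ne']; congr 1; push_cast; ring]
  ring

theorem tendsto_mul_rpow_half {δ : ℝ} (hδ : δ < 1) (r : ℝ) :
    Tendsto (fun t : ℝ => r * t ^ ((δ - 1) / 2)) atTop (𝓝 0) := by
  have := (tendsto_rpow_neg_atTop (y := (1 - δ) / 2) (by linarith)).const_mul r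
  rw [mul_zero] at this
  refine this.congr fun t => ?_
  congr 2
  ring

theorem tendsto_mul_PhiG_div_rpow {r δ : ℝ} (hr : 0 < r) (hδ : δ < 1) :
    Tendsto (fun t : ℝ => t * PhiG (r * t ^ ((δ - 1) / 2)) / (r ^ 2 / 4 * t ^ δ)) atTop (𝓝 1) := by
  have h0 : Tendsto (fun t : ℝ => r * t ^ ((δ - 1) / 2)) atTop (𝓝[>] 0) := by
    refine tendsto_nhdsWithin_iff.2 ⟨tendsto_mul_rpow_half hδ r, ?_⟩
    filter_upwards [eventually_gt_atTop 0] with t ht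
    exact Set.mem_Ioi.2 (by positivity)
  have h1 := (isEquivalent_iff_tendsto_one (by
    filter_upwards [self_mem_nhdsWithin] with s (hs : 0 < s)
    positivity)).1 PhiG_isEquivalent_nhdsGT
  refine (h1.comp h0).congr' ?_
  filter_upwards [eventually_gt_atTop 0] with t ht
  rw [Function.comp_apply, Pi.div_apply, ← mul_sq_rpow_half ht, mul_div_mul_left _ _ ht.ne']

theorem tendsto_add_log_div_rpow {c δ : ℝ} (a : ℝ) (hc : 0 < c) (hδ : 0 < δ) :
    Tendsto (fun t : ℝ => (a + Real.log t) / (c * t ^ δ)) atTop (𝓝 0) := by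
  have h1 : Tendsto (fun t : ℝ => a / (c * t ^ δ)) atTop (𝓝 0) :=
    tendsto_const_nhds.div_atTop ((tendsto_rpow_atTop hδ).const_mul_atTop hc)
  have h2 := ((isLittleO_log_rpow_atTop hδ).tendsto_div_nhds_zero).div_const c
  have := h1.add h2
  rw [zero_div, add_zero] at this
  refine this.congr fun t => ?_
  rw [div_div, mul_comm (t ^ δ), add_div]

theorem tendsto_log_mul_xiG_div_rpow {r δ : ℝ} (hr : 0 < r) (hδ0 : 0 < δ) (hδ : δ < 1) :
    Tendsto (fun t : ℝ => (1 + Real.log (t * xiG (r * t ^ ((δ - 1) / 2)))) / (r ^ 2 / 4 * t ^ δ))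
      atTop (𝓝 0) := by
  refine tendsto_of_tendsto_of_tendsto_of_le_of_le' tendsto_const_nhds
    (tendsto_add_log_div_rpow (c := r ^ 2 / 4) 2 (by positivity) hδ0) ?_ ?_
  · filter_upwards [eventually_ge_atTop 1] with t ht
    have := one_le_xiG (r * t ^ ((δ - 1) / 2))
    have := Real.log_nonneg (x := t * xiG (r * t ^ ((δ - 1) / 2))) (by nlinarith)
    positivity
  · filter_upwards [eventually_ge_atTop 1,
      (tendsto_mul_rpow_half hδ r).eventually (Icc_mem_nhds (a := -1) (b := 1) (by norm_num)
        (by norm_num))] with t ht hs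
    have h1 := log_xiG_le (r * t ^ ((δ - 1) / 2))
    have h2 : (r * t ^ ((δ - 1) / 2)) ^ 2 ≤ 1 := (sq_le_one_iff_abs_le_one _).2 (abs_le.2 hs)
    rw [Real.log_mul (by positivity) (xiG_pos _).ne']
    exact div_le_div_of_nonneg_right (by linarith) (by positivity)

theorem tendsto_log_regHeatKernel_moderate (d : ℕ) {r δ : ℝ} (hr : 0 < r) (hδ0 : 0 < δ)
    (hδ : δ < 1) :
    Tendsto (fun p : EuclideanSpace ℝ (Fin d) × ℝ =>
        Real.log (regHeatKernel (gaussKernel d) p.1 p.2) / (‖p.1‖ ^ 2 / (4 * p.2)))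
      (regime {p | ‖p.1‖ = r * p.2 ^ ((1 + δ) / 2)}) (𝓝 (-1)) := by
  have h := tendsto_log_regHeatKernel_div (d := d)
    (S := {p | ‖p.1‖ = r * p.2 ^ ((1 + δ) / 2)}) (r := fun p => r * p.2 ^ ((δ - 1) / 2))
    (N := fun p => r ^ 2 / 4 * p.2 ^ δ) (a := 1) ?_ ?_
    ((tendsto_mul_PhiG_div_rpow hr hδ).comp tendsto_snd_regime)
    ((tendsto_log_mul_xiG_div_rpow hr hδ0 hδ).comp tendsto_snd_regime)
  · refine h.congr' ?_
    filter_upwards [eventually_mem_regime, eventually_one_le_snd_regime] with p hp ht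
    have ht0 : 0 < p.2 := by linarith
    have hp' : ‖p.1‖ = r * p.2 ^ ((1 + δ) / 2) := hp
    rw [hp', ← mul_sq_rpow_half ht0, ← rpow_half_mul_self ht0]
    congr 1
    field_simp
  · filter_upwards [eventually_mem_regime, eventually_one_le_snd_regime] with p hp ht
    have ht0 : 0 < p.2 := by linarith
    have hp' : ‖p.1‖ = r * p.2 ^ ((1 + δ) / 2) := hp
    refine ⟨by positivity, ?_⟩
    rw [hp', mul_assoc, rpow_half_mul_self ht0]
  · filter_upwards [eventually_one_le_snd_regime] with p ht
    have ht0 : 0 < p.2 := by linarith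
    positivity

theorem exists_regHeatKernel_le_moderate (d : ℕ) {r δ : ℝ} (hr : 0 < r) (hδ : δ < 1) :
    ∃ ε : ℝ → ℝ, Tendsto ε atTop (𝓝 0) ∧ ∀ᶠ t : ℝ in atTop, ∀ x : EuclideanSpace ℝ (Fin d),
      r * t ^ ((1 + δ) / 2) ≤ ‖x‖ →
        regHeatKernel (gaussKernel d) x t ≤ Real.exp (-(r ^ 2 / 4 * t ^ δ * (1 + ε t))) := by
  refine ⟨fun t => t * PhiG (r * t ^ ((δ - 1) / 2)) / (r ^ 2 / 4 * t ^ δ) - 1,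
    by simpa using (tendsto_mul_PhiG_div_rpow hr hδ).sub_const 1, ?_⟩
  filter_upwards [eventually_gt_atTop 0] with t ht x hx
  rw [add_sub_cancel, mul_div_cancel₀ _ (by positivity)]
  refine regHeatKernel_le_exp_neg_PhiG ht (by positivity) ?_
  rwa [mul_assoc, rpow_half_mul_self ht]

theorem exists_le_regHeatKernel_moderate (d : ℕ) {r δ : ℝ} (hr : 0 < r) (hδ0 : 0 < δ)
    (hδ : δ < 1) :
    ∃ ε : ℝ → ℝ, Tendsto ε atTop (𝓝 0) ∧ ∀ᶠ t : ℝ in atTop, ∀ x : EuclideanSpace ℝ (Fin d),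
      ‖x‖ ≤ r * t ^ ((1 + δ) / 2) →
        Real.exp (-(r ^ 2 / 4 * t ^ δ * (1 + ε t))) ≤ regHeatKernel (gaussKernel d) x t := by
  obtain ⟨C, -, hC⟩ := exists_le_log_regHeatKernel d
  refine ⟨fun t => t * PhiG (r * t ^ ((δ - 1) / 2)) / (r ^ 2 / 4 * t ^ δ) +
    C * ((1 + Real.log (t * xiG (r * t ^ ((δ - 1) / 2)))) / (r ^ 2 / 4 * t ^ δ)) - 1, ?_, ?_⟩
  · simpa using ((tendsto_mul_PhiG_div_rpow hr hδ).add
      ((tendsto_log_mul_xiG_div_rpow hr hδ0 hδ).const_mul C)).sub_const 1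
  · filter_upwards [eventually_ge_atTop 1] with t ht x hx
    have ht0 : 0 < t := by linarith
    rw [add_sub_cancel, ← mul_div_assoc, ← add_div, mul_div_cancel₀ _ (by positivity), neg_add,
      ← sub_eq_add_neg, ← Real.le_log_iff_exp_le (regHeatKernel_gaussKernel_pos x ht0)]
    refine hC x _ t ht ?_
    rwa [mul_assoc, rpow_half_mul_self ht0]

/-! ### Large deviations: `|x| = r t` -/

theorem tendsto_log_regHeatKernel_large (d : ℕ) {r : ℝ} (hr : 0 < r) :
    Tendsto (fun p : EuclideanSpace ℝ (Fin d) × ℝ =>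
        Real.log (regHeatKernel (gaussKernel d) p.1 p.2) / p.2)
      (regime {p | ‖p.1‖ = r * p.2}) (𝓝 (-PhiG r)) := by
  refine tendsto_log_regHeatKernel_div (r := fun _ => r) ?_ ?_ ?_ ?_
  · filter_upwards [eventually_mem_regime] with p hp
    exact ⟨hr.le, hp⟩
  · filter_upwards [eventually_one_le_snd_regime] with p ht
    linarith
  · refine tendsto_const_nhds.congr' ?_
    filter_upwards [eventually_one_le_snd_regime] with p ht
    rw [mul_div_cancel_left₀ _ (by linarith)]
  · refine ((tendsto_add_log_div_rpow (1 + Real.log (xiG r)) one_pos one_pos).comp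
      tendsto_snd_regime).congr' ?_
    filter_upwards [eventually_one_le_snd_regime] with p ht
    rw [Function.comp_apply, Real.rpow_one, one_mul,
      Real.log_mul (by linarith) (xiG_pos r).ne']
    ring

/-! ### Extreme deviations: `|x| > t^{(1+δ)/2}` with `δ > 1` -/

theorem eventually_xiG_le : ∀ᶠ r in atTop, xiG r ≤ r := by
  filter_upwards [eventually_gt_atTop 0, tendsto_log_xiG_atTop.eventually_ge_atTop 1] with r hr h1
  rw [← Real.log_le_log_iff (xiG_pos r) hr, log_eq_log_xiG hr]
  have := Real.log_nonneg h1
  have : 0 ≤ Real.log 2 := Real.log_nonneg (by norm_num)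
  linarith

theorem tendsto_log_regHeatKernel_extreme (d : ℕ) {δ : ℝ} (hδ : 1 < δ) :
    Tendsto (fun p : EuclideanSpace ℝ (Fin d) × ℝ =>
        Real.log (regHeatKernel (gaussKernel d) p.1 p.2) /
          (‖p.1‖ * √(Real.log (‖p.1‖ / p.2))))
      (regime {p | p.2 ^ ((1 + δ) / 2) < ‖p.1‖}) (𝓝 (-1)) := by
  set S : Set (EuclideanSpace ℝ (Fin d) × ℝ) := {p | p.2 ^ ((1 + δ) / 2) < ‖p.1‖}
  have hr : Tendsto (fun p : EuclideanSpace ℝ (Fin d) × ℝ => ‖p.1‖ / p.2) (regime S) atTop := by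
    refine tendsto_atTop_mono' _ ?_
      ((tendsto_rpow_atTop (y := (δ - 1) / 2) (by linarith)).comp tendsto_snd_regime)
    filter_upwards [eventually_mem_regime, eventually_one_le_snd_regime] with p hp ht
    have ht0 : 0 < p.2 := by linarith
    rw [Function.comp_apply, le_div_iff₀ ht0, rpow_half_mul_self ht0]
    exact le_of_lt hp
  have hx : Tendsto (fun p : EuclideanSpace ℝ (Fin d) × ℝ => ‖p.1‖) (regime S) atTop := by
    refine tendsto_atTop_mono' _ ?_ hr
    filter_upwards [eventually_one_le_snd_regime] with p ht
    exact div_le_self (norm_nonneg _) ht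
  have hlog := (Real.tendsto_log_atTop.comp hr).eventually_ge_atTop 1
  refine tendsto_log_regHeatKernel_div (r := fun p => ‖p.1‖ / p.2) ?_ ?_ ?_ ?_
  · filter_upwards [eventually_one_le_snd_regime] with p ht
    have ht0 : 0 < p.2 := by linarith
    exact ⟨by positivity, by field_simp⟩
  · filter_upwards [hx.eventually_gt_atTop 0, hlog] with p hp hl
    exact mul_pos hp (Real.sqrt_pos.2 (lt_of_lt_of_le one_pos hl))
  · have h1 := (isEquivalent_iff_tendsto_one (by
      filter_upwards [eventually_gt_atTop 1] with s hs
      have := Real.log_pos hs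
      positivity)).1 PhiG_isEquivalent_atTop
    refine (h1.comp hr).congr' ?_
    filter_upwards [eventually_one_le_snd_regime] with p ht
    have ht0 : 0 < p.2 := by linarith
    rw [Function.comp_apply, Pi.div_apply, ← mul_div_mul_left _ _ ht0.ne', ← mul_assoc,
      mul_div_cancel₀ _ ht0.ne']
  · refine tendsto_of_tendsto_of_tendsto_of_le_of_le' tendsto_const_nhds
      ((tendsto_add_log_div_rpow 1 one_pos one_pos).comp hx) ?_ ?_
    · filter_upwards [eventually_one_le_snd_regime] with p ht
      have := one_le_xiG (‖p.1‖ / p.2)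
      have := Real.log_nonneg (x := p.2 * xiG (‖p.1‖ / p.2)) (by nlinarith)
      positivity
    · filter_upwards [eventually_one_le_snd_regime, hr.eventually eventually_xiG_le, hlog,
        hx.eventually_ge_atTop 1] with p ht hξ hl hp
      have ht0 : 0 < p.2 := by linarith
      have hξ0 := xiG_pos (‖p.1‖ / p.2)
      rw [Function.comp_apply, Real.rpow_one, one_mul]
      have h1 : p.2 * xiG (‖p.1‖ / p.2) ≤ ‖p.1‖ := by
        rw [le_div_iff₀ ht0] at hξ
        linarith
      have h2 := Real.log_le_log (by positivity) h1
      have h3 : 1 ≤ √(Real.log (‖p.1‖ / p.2)) := Real.one_le_sqrt.2 hl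
      have h4 := Real.log_nonneg hp
      gcongr
      nlinarith

/-! ### The central regime `|x| ≤ r t^{1/2}` -/

theorem abs_exp_sub_one_le_mul_exp {g M : ℝ} (hg : g ≤ M) (hM : 0 ≤ M) :
    |Real.exp g - 1| ≤ |g| * Real.exp M := by
  have hM1 := Real.one_le_exp hM
  rcases le_total 0 g with h | h
  · rw [abs_of_nonneg (by linarith [Real.one_le_exp h]), abs_of_nonneg h]
    have h1 := mul_le_mul_of_nonneg_left (Real.one_sub_le_exp_neg g) (Real.exp_pos g).le
    rw [← Real.exp_add, add_neg_cancel, Real.exp_zero] at h1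
    have h2 := mul_le_mul_of_nonneg_left (Real.exp_le_exp.2 hg) h
    linarith
  · rw [abs_of_nonpos (by linarith [Real.exp_le_one_iff.2 h]), abs_of_nonpos h]
    have h1 := Real.add_one_le_exp g
    nlinarith

/-- The quotient `s ↦ s^{-m} e^{c(1 - 1/s)}` of two heat kernels is Lipschitz on `[1/2, ∞)`. -/
theorem abs_exp_ratio_sub_one_le {c c₀ m s : ℝ} (hc : 0 ≤ c) (hc₀ : c ≤ c₀) (hm : 0 ≤ m)
    (hs : 1 / 2 ≤ s) :
    |Real.exp (c * (1 - 1 / s) - m * Real.log s) - 1| ≤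
      (2 * c₀ + 2 * m) * Real.exp (c₀ + m * Real.log 2) * |s - 1| := by
  have hs0 : 0 < s := by linarith
  have hc0 : 0 ≤ c₀ := hc.trans hc₀
  have hlog2 : 0 ≤ Real.log 2 := Real.log_nonneg (by norm_num)
  have h1 : |1 - 1 / s| ≤ 2 * |s - 1| := by
    rw [show 1 - 1 / s = (s - 1) / s by field_simp, abs_div, abs_of_pos hs0, div_le_iff₀ hs0]
    nlinarith [abs_nonneg (s - 1)]
  have h2 : |Real.log s| ≤ 2 * |s - 1| := by
    refine abs_le.2 ⟨?_, ?_⟩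
    · have := Real.one_sub_inv_le_log_of_pos hs0
      have := neg_le_of_abs_le h1
      rw [one_div] at this
      linarith
    · have := Real.log_le_sub_one_of_pos hs0
      linarith [le_abs_self (s - 1), abs_nonneg (s - 1)]
  have h3 : -Real.log 2 ≤ Real.log s := by
    rw [← Real.log_inv]
    exact Real.log_le_log (by norm_num) (by linarith)
  have h4 : c * (1 - 1 / s) ≤ c₀ := by
    have : 0 ≤ 1 / s := by positivity
    nlinarith
  refine (abs_exp_sub_one_le_mul_exp (M := c₀ + m * Real.log 2) (by nlinarith)
    (by nlinarith [mul_nonneg hm hlog2])).trans ?_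
  rw [mul_right_comm]
  gcongr
  calc |c * (1 - 1 / s) - m * Real.log s| ≤ |c * (1 - 1 / s)| + |m * Real.log s| := abs_sub _ _
    _ = c * |1 - 1 / s| + m * |Real.log s| := by
      rw [abs_mul, abs_mul, abs_of_nonneg hc, abs_of_nonneg hm]
    _ ≤ c₀ * (2 * |s - 1|) + m * (2 * |s - 1|) := by gcongr
    _ = (2 * c₀ + 2 * m) * |s - 1| := by ring

theorem classicalHeatKernel_div {d : ℕ} (x : EuclideanSpace ℝ (Fin d)) {k t : ℝ} (hk : 0 < k)
    (ht : 0 < t) :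
    classicalHeatKernel d x k / classicalHeatKernel d x t =
      Real.exp (‖x‖ ^ 2 / (4 * t) * (1 - 1 / (k / t)) - d / 2 * Real.log (k / t)) := by
  have hπ := Real.pi_pos
  rw [div_eq_iff (classicalHeatKernel_pos x ht).ne', classicalHeatKernel, classicalHeatKernel,
    Real.rpow_def_of_pos (by positivity), Real.rpow_def_of_pos (by positivity), ← Real.exp_add,
    ← Real.exp_add, ← Real.exp_add, Real.log_div hk.ne' ht.ne',
    Real.log_mul (by positivity) hk.ne', Real.log_mul (by positivity) ht.ne']
  congr 1
  field_simp
  ring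

theorem abs_le_exp_add_exp_neg (z : ℝ) : |z| ≤ Real.exp z + Real.exp (-z) := by
  have h1 := Real.add_one_le_exp z
  have h2 := Real.add_one_le_exp (-z)
  have h3 := Real.exp_pos z
  have h4 := Real.exp_pos (-z)
  exact abs_le.2 ⟨by linarith, by linarith⟩

/-- For `|u| ≤ 1` and `t u² = 1`, the centred Laplace transform of the Poisson distribution is at
most `e`. -/
theorem exp_poisson_mul_exp_le {t u : ℝ} (ht : 0 ≤ t) (hu : |u| ≤ 1) (htu : t * u ^ 2 = 1) :
    Real.exp (t * (Real.exp u - 1)) * Real.exp (-(t * u)) ≤ Real.exp 1 := by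
  rw [← Real.exp_add]
  refine Real.exp_le_exp.2 ?_
  have := mul_le_mul_of_nonneg_left (le_of_abs_le (Real.abs_exp_sub_one_sub_id_le hu)) ht
  linarith

/-- The relative error of a single heat kernel at time `k` against time `t`. Near `k = t` the
Lipschitz bound is made exponential, with `u = t^{-1/2}`; for `k < t/2` the crude bound
`1 + t^{d/2} e^{c₀}` is paid for by the factor `2^{t/2 - k} ≥ 1`. -/
theorem abs_heat_ratio_sub_one_le {d : ℕ} (x : EuclideanSpace ℝ (Fin d)) {c₀ t u : ℝ} (ht : 1 ≤ t)
    (hu : 0 < u) (htu : t * u ^ 2 = 1) (hx : ‖x‖ ^ 2 / (4 * t) ≤ c₀) (k : ℕ) :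
    |(if k = 0 then 0 else classicalHeatKernel d x k) / classicalHeatKernel d x t - 1| ≤
      (2 * c₀ + d) * Real.exp (c₀ + d / 2 * Real.log 2) * u *
        (Real.exp (-(t * u)) * Real.exp u ^ k + Real.exp (t * u) * Real.exp (-u) ^ k) +
      (1 + t ^ ((d : ℝ) / 2) * Real.exp c₀) * Real.exp (t / 2 * Real.log 2) * (1 / 2) ^ k := by
  have ht0 : 0 < t := by linarith
  have hlog2 : 0 < Real.log 2 := Real.log_pos (by norm_num)
  have hc0 : 0 ≤ ‖x‖ ^ 2 / (4 * t) := by positivity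
  have hc₀ : 0 ≤ c₀ := hc0.trans hx
  have hpow : Real.exp (t / 2 * Real.log 2) * (1 / 2) ^ k = Real.exp ((t / 2 - k) * Real.log 2) := by
    rw [sub_mul, sub_eq_add_neg, Real.exp_add, one_div, inv_pow, Real.exp_neg, Real.exp_nat_mul,
      Real.exp_log two_pos]
  rw [mul_assoc (1 + _), hpow]
  rcases lt_or_ge (k : ℝ) (t / 2) with hk | hk
  · have hone : 1 ≤ Real.exp ((t / 2 - k) * Real.log 2) :=
      Real.one_le_exp (mul_nonneg (by linarith) hlog2.le)
    have hB : 0 ≤ t ^ ((d : ℝ) / 2) * Real.exp c₀ := by positivity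
    have key : |(if k = 0 then 0 else classicalHeatKernel d x k) / classicalHeatKernel d x t - 1| ≤
        1 + t ^ ((d : ℝ) / 2) * Real.exp c₀ := by
      split_ifs with h0
      · simpa using hB
      · have hk1 : (1 : ℝ) ≤ k := by exact_mod_cast Nat.one_le_iff_ne_zero.2 h0
        have hk0 : (0 : ℝ) < k := by linarith
        rw [classicalHeatKernel_div x hk0 ht0]
        have hle : Real.exp (‖x‖ ^ 2 / (4 * t) * (1 - 1 / (k / t)) -
            d / 2 * Real.log (k / t)) ≤ t ^ ((d : ℝ) / 2) * Real.exp c₀ := by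
          rw [Real.rpow_def_of_pos ht0, ← Real.exp_add]
          refine Real.exp_le_exp.2 ?_
          have h1 : 0 ≤ 1 / (k / t) := by positivity
          have h2 : 0 ≤ (d : ℝ) / 2 * Real.log k := by
            have := Real.log_nonneg hk1
            positivity
          rw [Real.log_div hk0.ne' ht0.ne']
          nlinarith
        have hpos := Real.exp_pos (‖x‖ ^ 2 / (4 * t) * (1 - 1 / (k / t)) -
            d / 2 * Real.log (k / t))
        exact abs_le.2 ⟨by linarith, by linarith⟩
    refine key.trans ((le_mul_of_one_le_right (by positivity) hone).trans ?_)
    exact le_add_of_nonneg_left (by positivity)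
  · have hk0 : (0 : ℝ) < k := by linarith
    rw [if_neg (by exact_mod_cast hk0.ne'), classicalHeatKernel_div x hk0 ht0]
    have h1 := abs_exp_ratio_sub_one_le (m := (d : ℝ) / 2) hc0 hx (by positivity)
      (show 1 / 2 ≤ (k : ℝ) / t by rw [le_div_iff₀ ht0]; linarith)
    refine h1.trans (le_trans ?_ (le_add_of_nonneg_right (by positivity)))
    rw [mul_div_cancel₀ (d : ℝ) two_ne_zero, mul_assoc _ u]
    gcongr
    -- `k / t - 1 = u z` for the normalized deviation `z = (k - t) u`
    have hz : (k : ℝ) / t - 1 = u * (k * u - t * u) := by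
      field_simp
      linear_combination (t - k) * htu
    rw [hz, abs_mul, abs_of_pos hu]
    gcongr
    refine (abs_le_exp_add_exp_neg _).trans (le_of_eq ?_)
    rw [← Real.exp_nat_mul, ← Real.exp_nat_mul, ← Real.exp_add, ← Real.exp_add]
    congr 2 <;> ring

theorem abs_regHeatKernel_div_sub_one_le {d : ℕ} (x : EuclideanSpace ℝ (Fin d)) {c₀ t u : ℝ}
    (ht : 1 ≤ t) (hu : 0 < u) (htu : t * u ^ 2 = 1) (hx : ‖x‖ ^ 2 / (4 * t) ≤ c₀) :
    |regHeatKernel (gaussKernel d) x t / classicalHeatKernel d x t - 1| ≤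
      (2 * c₀ + d) * Real.exp (c₀ + d / 2 * Real.log 2) * u * (2 * Real.exp 1) +
      (1 + t ^ ((d : ℝ) / 2) * Real.exp c₀) * Real.exp (-((1 - Real.log 2) / 2) * t) := by
  have ht0 : 0 < t := by linarith
  have hu1 : u ≤ 1 := by
    by_contra! h
    nlinarith
  have hc₀ : 0 ≤ c₀ := le_trans (by positivity) hx
  have hone : HasSum (fun k : ℕ => Real.exp (-t) * (t ^ k / (k.factorial : ℝ))) 1 := by
    simpa using hasSum_poisson_mul_pow t 1
  have hsum := ((hasSum_regHeatKernel x ht0).div_const (classicalHeatKernel d x t)).sub hone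
  set A := (2 * c₀ + d) * Real.exp (c₀ + d / 2 * Real.log 2) * u
  set B := (1 + t ^ ((d : ℝ) / 2) * Real.exp c₀)
  have hA : 0 ≤ A := by positivity
  have hbound := (((hasSum_poisson_mul_pow t (Real.exp u)).mul_right (Real.exp (-(t * u)))).add
    ((hasSum_poisson_mul_pow t (Real.exp (-u))).mul_right (Real.exp (t * u)))).mul_left A |>.add
    ((hasSum_poisson_mul_pow t (1 / 2)).mul_left (B * Real.exp (t / 2 * Real.log 2)))
  have hnorm := hsum.norm_le_of_bounded hbound fun k => by
    have h := mul_le_mul_of_nonneg_left (abs_heat_ratio_sub_one_le x ht hu htu hx k)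
      (show 0 ≤ Real.exp (-t) * (t ^ k / (k.factorial : ℝ)) by positivity)
    have hp : 0 ≤ Real.exp (-t) * (t ^ k / (k.factorial : ℝ)) := by positivity
    rw [mul_div_assoc, ← mul_sub_one, norm_mul, Real.norm_of_nonneg hp, Real.norm_eq_abs]
    refine h.trans (le_of_eq ?_)
    ring
  rw [Real.norm_eq_abs] at hnorm
  refine hnorm.trans (add_le_add (mul_le_mul_of_nonneg_left ?_ hA) (le_of_eq ?_))
  · have h1 := exp_poisson_mul_exp_le ht0.le (abs_le.2 ⟨by linarith, hu1⟩) htu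
    have h2 := exp_poisson_mul_exp_le (u := -u) ht0.le (abs_le.2 ⟨by linarith, by linarith⟩)
      (by rwa [neg_sq])
    rw [mul_neg, neg_neg] at h2
    linarith
  · rw [mul_assoc, ← Real.exp_add]
    congr 2
    ring

/-- The relative error is `O(t^{-1/2})`, up to an exponentially small term. -/
theorem isLittleO_regHeatKernel_div_sub_one (d : ℕ) (r : ℝ) :
    (fun p : EuclideanSpace ℝ (Fin d) × ℝ =>
        regHeatKernel (gaussKernel d) p.1 p.2 / classicalHeatKernel d p.1 p.2 - 1)
      =o[regime {p | ‖p.1‖ ≤ r * p.2 ^ (1 / 2 : ℝ)}] fun p => p.2 ^ (-(1 / 4) : ℝ) := by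
  set c₀ : ℝ := r ^ 2 / 4 with hc₀
  have hβ : 0 < (1 - Real.log 2) / 2 := by linarith [Real.log_two_lt_d9]
  have hmain : (fun t : ℝ => (2 * c₀ + d) * Real.exp (c₀ + d / 2 * Real.log 2) *
      t ^ (-(1 / 2) : ℝ) * (2 * Real.exp 1) +
      (1 + t ^ ((d : ℝ) / 2) * Real.exp c₀) * Real.exp (-((1 - Real.log 2) / 2) * t))
      =o[atTop] fun t => t ^ (-(1 / 4) : ℝ) := by
    have h1 : (fun t : ℝ => t ^ (-(1 / 2) : ℝ)) =o[atTop] fun t => t ^ (-(1 / 4) : ℝ) := by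
      refine (isLittleO_iff_tendsto' ?_).2 ?_
      · filter_upwards [eventually_gt_atTop 0] with t ht h
        exact absurd h (by positivity)
      · refine (tendsto_rpow_neg_atTop (y := 1 / 4) (by norm_num)).congr' ?_
        filter_upwards [eventually_gt_atTop 0] with t ht
        rw [← Real.rpow_sub ht]
        norm_num
    have h2 : (fun t : ℝ => t ^ ((d : ℝ) / 2) * Real.exp (-((1 - Real.log 2) / 2) * t))
        =o[atTop] fun t => t ^ (-(1 / 4) : ℝ) := by
      refine ((isBigO_refl (fun t : ℝ => t ^ ((d : ℝ) / 2)) atTop).mul_isLittleO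
        (isLittleO_exp_neg_mul_rpow_atTop hβ (-(1 / 4) - d / 2))).congr' EventuallyEq.rfl ?_
      filter_upwards [eventually_gt_atTop 0] with t ht
      rw [← Real.rpow_add ht]
      congr 1
      ring
    refine ((h1.const_mul_left ((2 * c₀ + d) * Real.exp (c₀ + d / 2 * Real.log 2) *
      (2 * Real.exp 1))).add ((isLittleO_exp_neg_mul_rpow_atTop hβ (-(1 / 4))).add
      (h2.const_mul_left (Real.exp c₀)))).congr_left fun t => ?_
    ring
  refine IsBigO.trans_isLittleO (IsBigO.of_bound 1 ?_) (hmain.comp_tendsto tendsto_snd_regime)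
  filter_upwards [eventually_mem_regime, eventually_one_le_snd_regime] with p hp ht
  have ht0 : 0 < p.2 := by linarith
  have hp' : ‖p.1‖ ≤ r * p.2 ^ (1 / 2 : ℝ) := hp
  have hx : ‖p.1‖ ^ 2 / (4 * p.2) ≤ c₀ := by
    have h := pow_le_pow_left₀ (norm_nonneg _) hp' 2
    rw [mul_pow, ← Real.rpow_mul_natCast ht0.le] at h
    norm_num at h
    rw [div_le_iff₀ (by positivity), hc₀]
    linarith
  have htu : p.2 * (p.2 ^ (-(1 / 2) : ℝ)) ^ 2 = 1 := by
    rw [← Real.rpow_mul_natCast ht0.le]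
    norm_num
    rw [Real.rpow_neg_one, mul_inv_cancel₀ ht0.ne']
  rw [one_mul, Real.norm_eq_abs]
  exact (abs_regHeatKernel_div_sub_one_le p.1 ht (by positivity) htu hx).trans (le_abs_self _)

/-! ### The four regimes together -/

theorem mainTheorem1 (d : ℕ) :
    -- the convolutions and the series that define `v` exist
    ((∀ n : ℕ, ConvolutionExists (convPowSucc (gaussKernel d) n) (gaussKernel d)
        (ContinuousLinearMap.mul ℝ ℝ) volume) ∧
      ∀ (x : EuclideanSpace ℝ (Fin d)) (t : ℝ), 0 < t →
        Summable fun n : ℕ =>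
          t ^ (n + 1) * convPowSucc (gaussKernel d) n x / ((n + 1).factorial : ℝ)) ∧
    -- 1) `|x| ≤ r t^{1/2}`
    (∀ r : ℝ, 0 < r →
      (fun p : EuclideanSpace ℝ (Fin d) × ℝ =>
          regHeatKernel (gaussKernel d) p.1 p.2 / classicalHeatKernel d p.1 p.2 - 1)
        =o[regime {p | ‖p.1‖ ≤ r * p.2 ^ (1 / 2 : ℝ)}]
          fun p => p.2 ^ (-(1 / 4) : ℝ)) ∧
    -- 2) `|x| = r t^{(1+δ)/2}` with `0 < δ < 1`
    (∀ r δ : ℝ, 0 < r → 0 < δ → δ < 1 →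
      Tendsto (fun p : EuclideanSpace ℝ (Fin d) × ℝ =>
          Real.log (regHeatKernel (gaussKernel d) p.1 p.2) / (‖p.1‖ ^ 2 / (4 * p.2)))
        (regime {p | ‖p.1‖ = r * p.2 ^ ((1 + δ) / 2)}) (𝓝 (-1))) ∧
    (∀ r₁ r₂ δ : ℝ, 0 < r₁ → r₁ < r₂ → 0 < δ → δ < 1 →
      ∃ ε₁ ε₂ : ℝ → ℝ, Tendsto ε₁ atTop (𝓝 0) ∧ Tendsto ε₂ atTop (𝓝 0) ∧
        ∀ᶠ t : ℝ in atTop, ∀ x : EuclideanSpace ℝ (Fin d),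
          r₁ * t ^ ((1 + δ) / 2) ≤ ‖x‖ → ‖x‖ ≤ r₂ * t ^ ((1 + δ) / 2) →
            Real.exp (-(r₂ ^ 2 / 4 * t ^ δ * (1 + ε₂ t))) ≤ regHeatKernel (gaussKernel d) x t ∧
            regHeatKernel (gaussKernel d) x t ≤ Real.exp (-(r₁ ^ 2 / 4 * t ^ δ * (1 + ε₁ t)))) ∧
    -- 3) `|x| = r t`, and the properties of the rate function
    (∀ r : ℝ, 0 < r →
      Tendsto (fun p : EuclideanSpace ℝ (Fin d) × ℝ =>
          Real.log (regHeatKernel (gaussKernel d) p.1 p.2) / p.2)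
        (regime {p | ‖p.1‖ = r * p.2}) (𝓝 (-PhiG r))) ∧
    (∀ r : ℝ, r ≠ 0 → 0 < PhiG r ∧ PhiG r < r ^ 2 / 4) ∧
    (PhiG ~[𝓝[>] 0] fun r => r ^ 2 / 4) ∧
    (PhiG ~[atTop] fun r => r * Real.sqrt (Real.log r)) ∧
    -- 4) `|x| > t^{(1+δ)/2}` with `δ > 1`
    (∀ δ : ℝ, 1 < δ →
      Tendsto (fun p : EuclideanSpace ℝ (Fin d) × ℝ =>
          Real.log (regHeatKernel (gaussKernel d) p.1 p.2) /
            (‖p.1‖ * Real.sqrt (Real.log (‖p.1‖ / p.2))))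
        (regime {p | p.2 ^ ((1 + δ) / 2) < ‖p.1‖}) (𝓝 (-1))) := by
  exact ⟨⟨convolutionExists_convPowSucc_gaussKernel d, fun x t ht => summable_regHeatKernel x ht⟩,
    fun r _ => isLittleO_regHeatKernel_div_sub_one d r,
    fun r δ hr hδ0 hδ => tendsto_log_regHeatKernel_moderate d hr hδ0 hδ,
    fun r₁ r₂ δ hr₁ hr hδ0 hδ => by
      obtain ⟨ε₁, h₁, hv₁⟩ := exists_regHeatKernel_le_moderate d hr₁ hδ
      obtain ⟨ε₂, h₂, hv₂⟩ := exists_le_regHeatKernel_moderate d (hr₁.trans hr) hδ0 hδ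
      refine ⟨ε₁, ε₂, h₁, h₂, ?_⟩
      filter_upwards [hv₁, hv₂] with t ht₁ ht₂ x hx₁ hx₂
      exact ⟨ht₂ x hx₂, ht₁ x hx₁⟩,
    fun r hr => tendsto_log_regHeatKernel_large d hr,
    fun r hr => ⟨PhiG_pos hr, PhiG_lt hr⟩,
    PhiG_isEquivalent_nhdsGT, PhiG_isEquivalent_atTop,
    fun δ hδ => tendsto_log_regHeatKernel_extreme d hδ⟩
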